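/- Assume the Continuum Hypothesis. An ideal on a countably infinite set $\Lambda$ is a nonempty family $\mathcal I\subseteq\mathcal P(\Lambda)$ that is closed under subsets and finite unions, contains all finite subsets of $\Lambda$, and does not contain $\Lambda$. For ideals $\mathcal J$ on $\Gamma$ and $\mathcal I$ on $\Lambda$, write $\mathcal J\le_K\mathcal I$ if there is $\phi:\Lambda\to\Gamma$ with $\phi[A]\notin\mathcal J$ for every $A\notin\mathcal I$. Let $\mathrm{Fin}^2$ be the ideal of those $C\subseteq\omega^2$ for which $\{k:(n,k)\in C\}$ is infinite for only finitely many $n$, and let $$\mathcal{BI}=\{A\subseteq\omega^3:\ \exists k\ [\forall i<k\ (A_{(i)}\in\mathrm{Fin}^2)\ \wedge\ \forall i\ge k\ (A_{(i)}\text{ is finite})]\},\qquad A_{(i)}=\{(x,y):(i,x,y)\in A\}.$$ A topological space $X$ is in $\mathrm{FinBW}(\mathcal I)$ if for every $f:\Lambda\to X$ there is $A\subseteq\Lambda$, $A\notin\mathcal I$, such that $f\restriction A$ converges, i.e. for some $x\in X$ every neighbourhood $U$ of $x$ contains $f(\lambda)$ for all but finitely many $\lambda\in A$. For infinite $D\subseteq\omega$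 let $\mathrm{FS}(D)$ be the set of sums of finitely many (at least one) distinct elements of $D$, let $r(D)=[D]^2$ be the set of unordered pairs of distinct elements of $D$, and let $\Delta(D)=\{a-b:a,b\in D,\ a>b\}$. A space $X$ is Hindman (resp. Ramsey, resp. differentially compact) if, for $\rho=\mathrm{FS}$ (resp. $\rho=r$, resp. $\rho=\Delta$), every function $f$ from $\omega$ (resp. $[\omega]^2$, resp. $\omega$) to $X$ admits an infinite $D\subseteq\omega$ and a point $x\in X$ such that for every neighbourhood $U$ of $x$ there is a finite $K\subseteq\omega$ with $f[\rho(D\setminus K)]\subseteq U$. For an infinite almost disjoint family $\mathcal A$ on $\omega$ (infinite subsets of $\omega$ with pairwise finite intersections), $\Psi(\mathcal A)=\omega\cup\mathcal A$ carries the topology in which the points of $\omega$ are isolated and the basic neighbourhoods of $A\in\mathcal A$ are the sets $\{A\}\cup(A\setminus F)$ with $F$ finite, and $\Phi(\mathcal A)$ is the Alexandroff one-point compactification of $\Psi(\mathcal A)$. Then, for every ideal $\mathcal I$ on a countably infinite set, the following are equivalent: 1. $\mathcal{BI}\not\le_K\mathcal I$; 2. there is a Hausdorff space in $\mathrm{FinBW}(\mathcal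 I)$ that is not Hindman (resp. not Ramsey, resp. not differentially compact). Moreover, if $\mathcal{BI}\not\le_K\mathcal I$, then there is an infinite maximal almost disjoint family $\mathcal A$ on $\omega$ such that $\Phi(\mathcal A)$ is Hausdorff, compact, separable, of cardinality $\mathfrak c$, belongs to $\mathrm{FinBW}(\mathcal I)$, and is neither Hindman, nor Ramsey, nor differentially compact. -/

import Mathlib

open Filter Topology

universe u v

/-- `I` is an ideal on the set `Λ`: a nonempty family of subsets of `Λ`, closed under subsets and
finite unions, containing all finite subsets of `Λ` and not containing `Λ`. -/
structure IsIdealOn {Λ : Type u} (I : Set (Set Λ)) : Prop where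
  nonempty : I.Nonempty
  subset_mem : ∀ A B : Set Λ, A ∈ I → B ⊆ A → B ∈ I
  union_mem : ∀ A B : Set Λ, A ∈ I → B ∈ I → A ∪ B ∈ I
  finite_mem : ∀ A : Set Λ, A.Finite → A ∈ I
  univ_notMem : Set.univ ∉ I

/-- The Katětov order `J ≤_K I`, for `J` on `Γ` and `I` on `Λ`: some `φ : Λ → Γ` maps
`I`-positive sets to `J`-positive sets. -/
def KatetovLE {Γ : Type v} {Λ : Type u} (J : Set (Set Γ)) (I : Set (Set Λ)) : Prop :=
  ∃ φ : Λ → Γ, ∀ A : Set Λ, A ∉ I → φ '' A ∉ J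

/-- The ideal `Fin²` on `ω²`: all but finitely many vertical sections are finite. -/
def FinSq : Set (Set (ℕ × ℕ)) :=
  {C | {n : ℕ | ¬ {k : ℕ | (n, k) ∈ C}.Finite}.Finite}

/-- The section `A_(i) = {(x, y) : (i, x, y) ∈ A}` of `A ⊆ ω³`. -/
def sectionAt (A : Set (ℕ × ℕ × ℕ)) (i : ℕ) : Set (ℕ × ℕ) :=
  {p | (i, p.1, p.2) ∈ A}

/-- The ideal `𝓑𝓘` on `ω³`. -/
def BI : Set (Set (ℕ × ℕ × ℕ)) :=
  {A | ∃ k : ℕ, (∀ i < k, sectionAt A i ∈ FinSq) ∧ (∀ i ≥ k, (sectionAt A i).Finite)}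

/-- `X ∈ FinBW(I)`: for every `f : Λ → X` there is `A ∉ I` such that `f ↾ A` converges. -/
def FinBW {Λ : Type u} (I : Set (Set Λ)) (X : Type v) [TopologicalSpace X] : Prop :=
  ∀ f : Λ → X, ∃ A : Set Λ, A ∉ I ∧ ∃ x : X, Tendsto (A.domRestrict f) cofinite (𝓝 x)

/-- For an operation `ρ` from infinite subsets of `ω` to subsets of `Λ`, and `F` infinite:
`f ↾ ρ(F)` is `ρ`-convergent to `x`. -/
def RhoConverges {Λ : Type u} {X : Type v} [TopologicalSpace X]
    (ρ : Set ℕ → Set Λ) (F : Set ℕ) (f : Λ → X) (x : X) : Prop :=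
  ∀ U ∈ 𝓝 x, ∃ K : Set ℕ, K.Finite ∧ f '' ρ (F \ K) ⊆ U

/-- `X ∈ FinBW(ρ)`, for an operation `ρ` defined on the infinite subsets of `ω`. -/
def FinBWRho {Λ : Type u} (ρ : Set ℕ → Set Λ) (X : Type v) [TopologicalSpace X] : Prop :=
  ∀ f : Λ → X, ∃ F : Set ℕ, F.Infinite ∧ ∃ x : X, RhoConverges ρ F f x

/-- `FS(D)`: all sums of finitely many (at least one) distinct elements of `D`. -/
def finiteSums (D : Set ℕ) : Set ℕ :=
  {n | ∃ s : Finset ℕ, s.Nonempty ∧ (s : Set ℕ) ⊆ D ∧ n = ∑ i ∈ s, i}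

/-- `[ω]²`, the set of all unordered pairs of distinct natural numbers. -/
abbrev NatPair : Type := {e : Finset ℕ // e.card = 2}

/-- `r(H) = [H]²`, the set of all unordered pairs of distinct elements of `H`. -/
def pairsOf (H : Set ℕ) : Set NatPair :=
  {e | (e.1 : Set ℕ) ⊆ H}

/-- `Δ(E)`: all positive differences of elements of `E`. -/
def posDiffs (E : Set ℕ) : Set ℕ :=
  {d | ∃ a ∈ E, ∃ b ∈ E, b < a ∧ d = a - b}

/-- Hindman spaces. -/
def HindmanSpace (X : Type v) [TopologicalSpace X] : Prop := FinBWRho finiteSums X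

/-- Ramsey spaces. -/
def RamseySpace (X : Type v) [TopologicalSpace X] : Prop := FinBWRho pairsOf X

/-- Differentially compact spaces. -/
def DiffCompactSpace (X : Type v) [TopologicalSpace X] : Prop := FinBWRho posDiffs X

/-- Almost disjoint families on a countably infinite set (where "of the same cardinality as `Λ`"
means infinite and "of smaller cardinality than `Λ`" means finite). -/
def IsAlmostDisjointFamily {Λ : Type u} (𝒜 : Set (Set Λ)) : Prop :=
  (∀ A ∈ 𝒜, A.Infinite) ∧ ∀ A ∈ 𝒜, ∀ B ∈ 𝒜, A ≠ B → (A ∩ B).Finite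

/-- Maximal (with respect to inclusion) almost disjoint families. -/
def IsMADFamily {Λ : Type u} (𝒜 : Set (Set Λ)) : Prop :=
  Maximal IsAlmostDisjointFamily 𝒜

/-- The underlying set `Λ ∪ 𝒜` of the Mrówka space `Ψ(𝒜)`. -/
inductive MrowkaSpace {Λ : Type u} (𝒜 : Set (Set Λ)) : Type u
  | point (n : Λ) : MrowkaSpace 𝒜
  | member (A : 𝒜) : MrowkaSpace 𝒜

/-- The topology of `Ψ(𝒜)`: points of `Λ` are isolated, and basic neighbourhoods of `A ∈ 𝒜` are
the sets `{A} ∪ (A \ F)` with `F` finite. So `U` is open iff it contains all but finitely many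
points of each `A ∈ 𝒜` that belongs to `U`. -/
instance MrowkaSpace.instTopologicalSpace {Λ : Type u} (𝒜 : Set (Set Λ)) :
    TopologicalSpace (MrowkaSpace 𝒜) where
  IsOpen U := ∀ A : 𝒜, MrowkaSpace.member A ∈ U →
    ∃ F : Set Λ, F.Finite ∧ ∀ n ∈ (A : Set Λ) \ F, MrowkaSpace.point n ∈ U
  isOpen_univ := fun _ _ => ⟨∅, Set.finite_empty, fun _ _ => Set.mem_univ _⟩
  isOpen_inter := by
    intro U V hU hV A hA
    obtain ⟨F, hF, h1⟩ := hU A hA.1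
    obtain ⟨G, hG, h2⟩ := hV A hA.2
    exact ⟨F ∪ G, hF.union hG, fun n hn =>
      ⟨h1 n ⟨hn.1, fun h => hn.2 (Or.inl h)⟩, h2 n ⟨hn.1, fun h => hn.2 (Or.inr h)⟩⟩⟩
  isOpen_sUnion := by
    intro S hS A hA
    obtain ⟨U, hU, hAU⟩ := hA
    obtain ⟨F, hF, h⟩ := hS U hU A hAU
    exact ⟨F, hF, fun n hn => ⟨U, hU, h n hn⟩⟩

/-- `Φ(𝒜)`, the Alexandroff one-point compactification of `Ψ(𝒜)`. -/
abbrev FranklinSpace {Λ : Type u} (𝒜 : Set (Set Λ)) : Type u := OnePoint (MrowkaSpace 𝒜)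

/-! ### Transfer of convergence properties -/

section Convergence

variable {Λ : Type u} {X : Type v} [TopologicalSpace X]

/-! If `BI` is Katětov below `I`, then `FinBW I` passes to `FinBW BI`, and a Hausdorff space in
`FinBW BI` is tame: for countable R only finitely many points are limits of injective sequences from
R, and every open set around these limits contains almost all of R. Otherwise infinitely many such
sequences would be the rows of a map on ω³ that converges on no `BI`-positive set. Hence along any
ultrafilter containing R, a decreasing sequence of members shrinks to a point
(`FinBW.exists_limit_of_ultrafilter`). This replaces first countability in the ultrafilter proofs of
Ramsey's and Hindman's theorems; differential compactness follows from either.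

Conversely, CH allows a MAD family 𝒜 to be built through countable stages, one for each pair (L, f).
By `IsIdealOn.exists_finite_to_one_or_katetov`, f is finite-to-one on a positive set whose image
lies in an old member or can be added as a new one, unless `I` on L is above `BI`. A map into Φ(𝒜)
then converges on a positive set: on a large fibre, to a member of 𝒜, or to ∞. If all of this fails,
Katětov maps on two complementary parts of the domain glue to `BI ≤_K I`.

The family starts from the classes of constant 2-adic valuation. A Δ-limit of the inclusion of ω
would be some A ∈ 𝒜 containing some Δ(F) with F infinite. As Δ(F) meets a valuation class
infinitely, A is that class; but no class contains such a Δ(F). Hindman and Ramsey spaces being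
differentially compact, this one space refutes all three properties. -/

theorem tendsto_domRestrict_cofinite_iff {A : Set Λ} {f : Λ → X} {x : X} :
    Tendsto (A.domRestrict f) cofinite (𝓝 x) ↔ ∀ U ∈ 𝓝 x, {a ∈ A | f a ∉ U}.Finite := by
  rw [tendsto_def]
  refine forall₂_congr fun U _ => ?_
  rw [mem_cofinite, ← Set.finite_image_iff (f := Subtype.val) Subtype.val_injective.injOn]
  refine iff_of_eq (congrArg _ ?_)
  ext a
  by_cases ha : a ∈ A <;> simp [ha]

theorem FinBW.of_katetovLE {Γ : Type*} {J : Set (Set Γ)} {I : Set (Set Λ)} (h : KatetovLE J I)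
    (hX : FinBW I X) : FinBW J X := by
  obtain ⟨φ, hφ⟩ := h
  intro f
  obtain ⟨A, hA, x, hx⟩ := hX (f ∘ φ)
  refine ⟨φ '' A, hφ A hA, x, ?_⟩
  rw [tendsto_domRestrict_cofinite_iff] at hx ⊢
  intro U hU
  refine ((hx U hU).image φ).subset ?_
  rintro _ ⟨⟨a, ha, rfl⟩, haU⟩
  exact ⟨a, ⟨ha, haU⟩, rfl⟩

theorem FinBW.homeomorph {Y : Type*} [TopologicalSpace Y] {I : Set (Set Λ)} (e : X ≃ₜ Y)
    (hX : FinBW I X) : FinBW I Y := by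
  intro f
  obtain ⟨A, hA, x, hx⟩ := hX (e.symm ∘ f)
  refine ⟨A, hA, e x, ?_⟩
  have := (e.continuous.tendsto x).comp hx
  convert this using 1
  ext a
  simp

theorem FinBWRho.homeomorph {Y : Type*} [TopologicalSpace Y] {ρ : Set ℕ → Set Λ} (e : X ≃ₜ Y)
    (hX : FinBWRho ρ X) : FinBWRho ρ Y := by
  intro f
  obtain ⟨F, hF, x, hx⟩ := hX (e.symm ∘ f)
  refine ⟨F, hF, e x, fun U hU => ?_⟩
  obtain ⟨K, hK, h⟩ := hx (e ⁻¹' U) (e.continuous.continuousAt hU)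
  refine ⟨K, hK, ?_⟩
  rintro _ ⟨a, ha, rfl⟩
  simpa using h ⟨a, ha, rfl⟩

end Convergence

/-! ### Hausdorff spaces in `FinBW BI` -/

section CriticalIdeal

theorem infinite_of_notMem_BI {A : Set (ℕ × ℕ × ℕ)} (hA : A ∉ BI) : A.Infinite := by
  refine fun hfin => hA ⟨0, by simp, fun i _ => ?_⟩
  exact hfin.preimage (f := fun p : ℕ × ℕ => (i, p.1, p.2)) fun p _ q _ h => by simpa using h

theorem exists_infinite_section_of_notMem_BI {A : Set (ℕ × ℕ × ℕ)} (hA : A ∉ BI) :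
    (∃ i, sectionAt A i ∉ FinSq) ∨ ∀ k, ∃ i ≥ k, (sectionAt A i).Infinite := by
  by_contra! h
  obtain ⟨h1, k, hk⟩ := h
  exact hA ⟨k, fun i _ => h1 i, fun i hi => hk i hi⟩

theorem mem_BI_of_subset {A B : Set (ℕ × ℕ × ℕ)} (hB : B ∈ BI) (h : A ⊆ B) : A ∈ BI := by
  obtain ⟨k, h1, h2⟩ := hB
  refine ⟨k, fun i hi => ?_, fun i hi => (h2 i hi).subset fun p hp => h hp⟩
  refine (h1 i hi).subset fun n hn hf => hn (hf.subset fun k hk => h hk)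

variable {X : Type v} [TopologicalSpace X]

theorem FinBW.exists_injective_tendsto (hX : FinBW BI X) {E : Set X} (hE : E.Infinite) :
    ∃ (p : X) (q : ℕ → X), q.Injective ∧ (∀ n, q n ∈ E) ∧ Tendsto q atTop (𝓝 p) := by
  obtain ⟨e⟩ := nonempty_denumerable (ℕ × ℕ × ℕ)
  let g : ℕ × ℕ × ℕ → X := fun t => hE.natEmbedding E (Encodable.encode t)
  have hg : g.Injective := fun a b h => by
    have := (hE.natEmbedding E).injective (Subtype.ext h)
    exact Encodable.encode_injective this
  obtain ⟨A, hA, p, hp⟩ := hX g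
  have hinf := infinite_of_notMem_BI hA
  let s := hinf.natEmbedding A
  refine ⟨p, fun n => g (s n), fun a b h => s.injective (Subtype.ext (hg h)),
    fun n => Subtype.coe_prop _, ?_⟩
  have := hp.comp (s.injective.tendsto_cofinite)
  rw [Nat.cofinite_eq_atTop] at this
  exact this

/-- A double sequence `q i x` with pairwise distinct row limits `p i`, whose rows eventually avoid
any prescribed point, contradicts `FinBW BI`. -/
theorem FinBW.not_exists_rows [T2Space X] (hX : FinBW BI X) {p : ℕ → X} {q : ℕ → ℕ → X}
    (hp : p.Injective) (hq : ∀ i, (q i).Injective) (hlim : ∀ i, Tendsto (q i) atTop (𝓝 (p i)))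
    (havoid : ∀ z, ∃ m, ∀ i ≥ m, ∀ x, q i x ≠ z) : False := by
  obtain ⟨A, hA, z, hz⟩ := hX (fun t => q t.1 t.2.1)
  rw [tendsto_domRestrict_cofinite_iff] at hz
  -- The map is constant on a column, and points are closed.
  have hcol : ∀ i x, {y | (x, y) ∈ sectionAt A i}.Infinite → q i x = z := by
    intro i x hinf
    by_contra hne
    have hfin := hz {q i x}ᶜ (isOpen_compl_singleton.mem_nhds fun h => hne h.symm)
    refine hinf ((hfin.preimage (f := fun y : ℕ => (i, x, y)) fun a _ b _ h => by
      simpa using h).subset fun y hy => ?_)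
    exact ⟨hy, by simp⟩
  rcases exists_infinite_section_of_notMem_BI hA with ⟨i, hi⟩ | hinf
  · have hi : {x | ¬ {y | (x, y) ∈ sectionAt A i}.Finite}.Infinite := hi
    obtain ⟨a, ha, b, hb, hab⟩ := hi.nontrivial
    exact hab (hq i ((hcol i a ha).trans (hcol i b hb).symm))
  obtain ⟨m, hm⟩ := havoid z
  -- Past m no column is infinite, so an infinite section reaches columns arbitrarily far out, where
  -- the row is close to p i.
  have key : ∀ i ≥ m, (sectionAt A i).Infinite → z = p i := by
    intro i him hinf
    by_contra hne
    obtain ⟨U, V, hU, hV, hzU, hpV, hUV⟩ := t2_separation hne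
    obtain ⟨N, hN⟩ := eventually_atTop.1 ((hlim i).eventually (hV.mem_nhds hpV))
    have h1 := (hz U (hU.mem_nhds hzU)).preimage (f := fun t : ℕ × ℕ => (i, t.1, t.2))
      fun a _ b _ h => by simpa [Prod.ext_iff] using h
    have h2 : (⋃ x ∈ Set.Iio N, (fun y => (x, y)) '' {y | (x, y) ∈ sectionAt A i}).Finite := by
      refine (Set.finite_Iio N).biUnion fun x _ => Set.Finite.image _ ?_
      by_contra hx
      exact hm i him x (hcol i x hx)
    refine hinf ((h1.union h2).subset ?_)
    rintro ⟨x, y⟩ hxy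
    by_cases hx : x < N
    · right
      simp only [Set.mem_iUnion]
      exact ⟨x, hx, y, hxy, rfl⟩
    · left
      exact ⟨hxy, fun h => Set.disjoint_left.1 hUV h (hN x (not_lt.1 hx))⟩
  obtain ⟨i, hi, h1⟩ := hinf m
  obtain ⟨j, hj, h2⟩ := hinf (i + 1)
  have : i = j := hp ((key i hi h1).symm.trans (key j (by omega) h2))
  omega

/-- Infinitely many limits would supply the rows excluded by `FinBW.not_exists_rows`. An infinite
part of R outside U would contain an injective sequence converging to a point of L, hence of U. -/
theorem FinBW.exists_finite_limits [T2Space X] (hX : FinBW BI X) {R : Set X} (hR : R.Countable) :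
    ∃ L : Set X, L.Finite ∧ ∀ U, IsOpen U → L ⊆ U → (R \ U).Finite := by
  let L : Set X := {p | ∃ q : ℕ → X, q.Injective ∧ (∀ n, q n ∈ R) ∧ Tendsto q atTop (𝓝 p)}
  refine ⟨L, ?_, ?_⟩
  · by_contra hL
    have hL : L.Infinite := hL
    let p := hL.natEmbedding L
    choose q hq hqR hlim using fun i => (p i).2
    have hne : R.Nonempty := ⟨_, hqR 0 0⟩
    obtain ⟨e, rfl⟩ := hR.exists_eq_range hne
    -- Truncating row i makes it miss the first i + 1 listed points of R, so each point of R is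
    -- missed by almost all rows.
    have hshift : ∀ i, ∃ N, ∀ x ≥ N, ∀ j ≤ i, q i x ≠ e j := by
      intro i
      have : ∀ j, ∀ᶠ x in atTop, q i x ≠ e j := by
        intro j
        rw [← Nat.cofinite_eq_atTop]
        have := (hq i).tendsto_cofinite.eventually
          (Set.Finite.compl_mem_cofinite (Set.finite_singleton (e j)))
        exact this
      have h := (Set.finite_Iic i).eventually_all.2 fun j _ => this j
      obtain ⟨N, hN⟩ := eventually_atTop.1 h
      exact ⟨N, hN⟩
    choose N hN using hshift
    refine hX.not_exists_rows (p := fun i => (p i : X)) (q := fun i x => q i (x + N i))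
      (fun a b h => p.injective (Subtype.ext h)) (fun i a b h => by simpa using hq i h)
      (fun i => (hlim i).comp (tendsto_add_atTop_nat (N i))) fun z => ?_
    by_cases hz : ∃ m, e m = z
    · obtain ⟨m, rfl⟩ := hz
      exact ⟨m, fun i hi x => hN i _ (Nat.le_add_left _ _) m hi⟩
    · refine ⟨0, fun i _ x h => hz ?_⟩
      obtain ⟨m, hm⟩ := hqR i (x + N i)
      exact ⟨m, hm.trans h⟩
  · intro U hU hLU
    by_contra hinf
    obtain ⟨p, q, hq, hqE, hlim⟩ := hX.exists_injective_tendsto (E := R \ U) hinf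
    have hp : p ∈ U := hLU ⟨q, hq, fun n => (hqE n).1, hlim⟩
    obtain ⟨n, hn⟩ := (hlim.eventually (hU.mem_nhds hp)).exists
    exact (hqE n).2 hn

theorem FinBW.exists_limit_of_ultrafilter [T2Space X] (hX : FinBW BI X) {R : Set X}
    (hR : R.Countable) {𝒱 : Ultrafilter X} (hRV : R ∈ 𝒱) :
    ∃ (x : X) (V : ℕ → Set X), Antitone V ∧ (∀ n, V n ∈ 𝒱) ∧ ∀ U ∈ 𝓝 x, ∃ n, V n ⊆ U := by
  by_cases hpr : ∃ x, {x} ∈ 𝒱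
  · obtain ⟨x, hx⟩ := hpr
    exact ⟨x, fun _ => {x}, antitone_const, fun _ => hx,
      fun U hU => ⟨0, Set.singleton_subset_iff.2 (mem_of_mem_nhds hU)⟩⟩
  push Not at hpr
  have hfin : ∀ s : Set X, s.Finite → sᶜ ∈ 𝒱 := by
    intro s hs
    rw [Ultrafilter.compl_mem_iff_notMem]
    intro h
    rw [← Set.biUnion_of_singleton s, Ultrafilter.finite_biUnion_mem_iff hs] at h
    obtain ⟨x, -, hx⟩ := h
    exact hpr x hx
  obtain ⟨L, hL, hLU⟩ := hX.exists_finite_limits hR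
  obtain ⟨W, hW, hdisj⟩ := hL.t2_separation
  have hcov : (⋃ p ∈ L, W p) ∈ 𝒱 := by
    have h1 := hLU (⋃ p ∈ L, W p) (isOpen_biUnion fun p _ => (hW p).2)
      fun p hp => Set.mem_biUnion hp (hW p).1
    filter_upwards [hRV, hfin _ h1] with y hy hy'
    by_contra h
    exact hy' ⟨hy, h⟩
  rw [Ultrafilter.finite_biUnion_mem_iff hL] at hcov
  obtain ⟨p, hp, hpW⟩ := hcov
  obtain ⟨e, he⟩ := hR.exists_eq_range (Ultrafilter.nonempty_of_mem hRV)
  refine ⟨p, fun n => (W p ∩ R) \ e '' Set.Iio n, fun a b hab => ?_, fun n => ?_, fun U hU => ?_⟩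
  · exact Set.sdiff_subset_sdiff_right (Set.image_mono (Set.Iio_subset_Iio hab))
  · exact inter_mem (inter_mem hpW hRV) (hfin _ ((Set.finite_Iio n).image e))
  · obtain ⟨O, hOU, hO, hpO⟩ := mem_nhds_iff.1 hU
    -- This open set contains L, so it misses finitely many points of R. Points of W p lie in no
    -- other W r, so almost all points of W p ∩ R are in O.
    have h1 := hLU (O ∪ ⋃ r ∈ L \ {p}, W r)
      (hO.union (isOpen_biUnion fun r _ => (hW r).2)) fun r hr => by
        by_cases h : r = p
        · exact Or.inl (h ▸ hpO)
        · exact Or.inr (Set.mem_biUnion ⟨hr, h⟩ (hW r).1)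
    have h2 : ∃ n, R \ (O ∪ ⋃ r ∈ L \ {p}, W r) ⊆ e '' Set.Iio n := by
      have hsub : R \ (O ∪ ⋃ r ∈ L \ {p}, W r) ⊆ e '' Set.univ := by
        rw [Set.image_univ, ← he]
        exact Set.sdiff_subset
      obtain ⟨t, -, ht, hte⟩ := Set.exists_subset_image_finite_and.1
        ⟨_, hsub, h1, rfl⟩
      obtain ⟨n, hn⟩ := ht.bddAbove
      refine ⟨n + 1, hte ▸ Set.image_mono fun k hk => ?_⟩
      exact Nat.lt_succ_of_le (hn hk)
    obtain ⟨n, hn⟩ := h2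
    refine ⟨n, ?_⟩
    rintro y ⟨⟨hyW, hyR⟩, hyn⟩
    by_contra hyU
    refine hyn (hn ⟨hyR, ?_⟩)
    rintro (h | h)
    · exact hyU (hOU h)
    · simp only [Set.mem_iUnion] at h
      obtain ⟨r, ⟨hr, hrp⟩, hyr⟩ := h
      exact Set.disjoint_left.1 (hdisj hr hp hrp) hyr hyW

end CriticalIdeal

/-! ### Ramsey spaces via the tensor square of an ultrafilter -/

section Ramsey

variable {X : Type v} [TopologicalSpace X]

/-- The pair `{a, b}`, with the junk value `{0, 1}` when `a = b`. -/
def natPair (a b : ℕ) : NatPair :=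
  if h : a ≠ b then ⟨{a, b}, Finset.card_pair h⟩ else ⟨{0, 1}, rfl⟩

theorem natPair_val {a b : ℕ} (h : a ≠ b) : (natPair a b).1 = {a, b} := by
  simp [natPair, h]

theorem FinBW.ramseySpace [T2Space X] (hX : FinBW BI X) : RamseySpace X := by
  intro f
  let W : Ultrafilter ℕ := hyperfilter ℕ
  let 𝒱 : Ultrafilter X := W.bind fun a => W.map fun b => f (natPair a b)
  have hmem : ∀ V, V ∈ 𝒱 ↔ ∀ᶠ a in W, ∀ᶠ b in W, f (natPair a b) ∈ V := fun V => Iff.rfl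
  obtain ⟨x, V, hanti, hV, hVx⟩ := hX.exists_limit_of_ultrafilter (Set.countable_range f)
    (𝒱 := 𝒱) ((hmem _).2 (Eventually.of_forall fun a => Eventually.of_forall fun b => ⟨_, rfl⟩))
  have hgt : ∀ n : ℕ, ∀ᶠ b in W, n < b := fun n =>
    Nat.hyperfilter_le_atTop (eventually_gt_atTop n)
  -- A state is a level with a chosen number, whose pairs with all later numbers must land in `V` of
  -- that level. Levels strictly increase, so the i-th is at least i.
  obtain ⟨s, hs, hsr⟩ := exists_seq_of_forall_finset_exists
    (fun t : ℕ × ℕ => ∀ᶠ b in W, f (natPair t.2 b) ∈ V t.1)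
    (fun t t' => t.1 < t'.1 ∧ t.2 < t'.2 ∧ f (natPair t.2 t'.2) ∈ V t.1) (by
      intro S hS
      have h1 : ∀ᶠ b in W, ∀ t ∈ S, t.2 < b ∧ f (natPair t.2 b) ∈ V t.1 :=
        S.eventually_all.2 fun t ht => (hgt t.2).and (hS t ht)
      let k := S.sup Prod.fst + 1
      obtain ⟨b, hb, hb'⟩ := (h1.and ((hmem _).1 (hV k))).exists
      refine ⟨(k, b), hb', fun t ht => ⟨?_, hb t ht⟩⟩
      exact Nat.lt_succ_of_le (Finset.le_sup (f := Prod.fst) ht))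
  have hmono1 : StrictMono fun n => (s n).1 := fun a b hab => (hsr a b hab).1
  have hmono2 : StrictMono fun n => (s n).2 := fun a b hab => (hsr a b hab).2.1
  refine ⟨Set.range fun n => (s n).2, Set.infinite_range_of_injective hmono2.injective, x,
    fun U hU => ?_⟩
  obtain ⟨n, hn⟩ := hVx U hU
  refine ⟨(fun i => (s i).2) '' Set.Iio n, (Set.finite_Iio n).image _, ?_⟩
  rintro _ ⟨⟨e, he⟩, heH, rfl⟩
  have heH : (e : Set ℕ) ⊆ _ := heH
  obtain ⟨a, b, hab, rfl⟩ := Finset.card_eq_two.1 he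
  have key : ∀ i j, i < j → n ≤ i → f (natPair (s i).2 (s j).2) ∈ U := fun i j hij hni =>
    hn (hanti (hni.trans (hmono1.le_apply)) (hsr i j hij).2.2)
  have hidx : ∀ c ∈ ({a, b} : Finset ℕ), ∃ i, n ≤ i ∧ (s i).2 = c := by
    intro c hc
    obtain ⟨⟨i, rfl⟩, hi⟩ := heH hc
    exact ⟨i, not_lt.1 fun h => hi ⟨i, h, rfl⟩, rfl⟩
  obtain ⟨i, hi, rfl⟩ := hidx a (by simp)
  obtain ⟨j, hj, rfl⟩ := hidx b (by simp)
  rcases lt_trichotomy i j with h | h | h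
  · convert key i j h hi using 2
    exact Subtype.ext (natPair_val hab).symm
  · exact absurd (by rw [h]) hab
  · convert key j i h hj using 2
    exact Subtype.ext ((Finset.pair_comm _ _).trans (natPair_val hab.symm).symm)

/-- Colour a pair by the value of f at its maximum minus its minimum. -/
theorem RamseySpace.diffCompactSpace (hX : RamseySpace X) : DiffCompactSpace X := by
  intro f
  obtain ⟨F, hF, x, hx⟩ := hX fun e => f (e.1.sup id - e.1.inf' (Finset.card_pos.1 (by
    rw [e.2]; norm_num)) id)
  refine ⟨F, hF, x, fun U hU => ?_⟩
  obtain ⟨K, hK, h⟩ := hx U hU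
  refine ⟨K, hK, ?_⟩
  rintro _ ⟨_, ⟨a, ha, b, hb, hab, rfl⟩, rfl⟩
  have := h ⟨⟨{a, b}, Finset.card_pair hab.ne'⟩, by
    intro c hc
    simp only [Finset.coe_insert, Finset.coe_singleton] at hc
    rcases hc with rfl | rfl <;> assumption, rfl⟩
  simpa [hab.le] using this

end Ramsey

/-! ### Hindman spaces via idempotent ultrafilters -/

section Hindman

variable {X : Type v} [TopologicalSpace X]

attribute [local instance] Ultrafilter.addSemigroup in
-- Positive integers are used because over ℕ the idempotent could be the principal ultrafilter at 0.
theorem exists_idempotent_ultrafilter_pnat :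
    ∃ 𝒰 : Ultrafilter ℕ+, ∀ p : ℕ+ → Prop, (∀ᶠ m in 𝒰, p m) ↔ ∀ᶠ m in 𝒰, ∀ᶠ n in 𝒰, p (m + n) := by
  obtain ⟨𝒰, h⟩ := exists_idempotent_of_compact_t2_of_continuous_add_left
    (@Ultrafilter.continuous_add_left ℕ+ _)
  refine ⟨𝒰, fun p => ?_⟩
  conv_lhs => rw [← h]
  exact Ultrafilter.eventually_add _ _ _

theorem eventually_gt_of_idempotent {𝒰 : Ultrafilter ℕ+}
    (h𝒰 : ∀ p : ℕ+ → Prop, (∀ᶠ m in 𝒰, p m) ↔ ∀ᶠ m in 𝒰, ∀ᶠ n in 𝒰, p (m + n)) (k : ℕ+) :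
    ∀ᶠ m in 𝒰, k < m := by
  by_contra h
  have hk : Set.Iic k ∈ 𝒰 := by
    rw [← Ultrafilter.eventually_not] at h
    filter_upwards [h] with m hm using not_lt.1 hm
  rw [← Set.biUnion_of_singleton (Set.Iic k),
    Ultrafilter.finite_biUnion_mem_iff (Set.finite_Iic k)] at hk
  obtain ⟨a, -, ha⟩ := hk
  have h1 : ∀ᶠ m in 𝒰, m = a := ha
  have h2 := (h𝒰 fun m => m = a).1 h1
  obtain ⟨m, hm, rfl⟩ := (h2.and h1).exists
  obtain ⟨n, hn⟩ := hm.exists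
  have := congrArg PNat.val hn
  have := n.pos
  simp only [PNat.add_coe] at *
  omega

theorem FinBW.hindmanSpace [T2Space X] (hX : FinBW BI X) : HindmanSpace X := by
  intro f
  obtain ⟨𝒰, h𝒰⟩ := exists_idempotent_ultrafilter_pnat
  obtain ⟨x, V, hanti, hV, hVx⟩ := hX.exists_limit_of_ultrafilter (Set.countable_range f)
    (𝒱 := 𝒰.map fun m : ℕ+ => f m) (Ultrafilter.mem_map.2 (univ_mem' fun m => ⟨_, rfl⟩))
  -- Galvin–Glazer recursion: a state is a level, a large set A and some d ∈ A. Each later set A'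
  -- satisfies A' ⊆ A and d + A' ⊆ A.
  obtain ⟨s, hs, hsr⟩ := exists_seq_of_forall_finset_exists
    (fun t : ℕ × Set ℕ+ × ℕ+ => t.2.1 ∈ 𝒰 ∧ (∀ m ∈ t.2.1, f m ∈ V t.1) ∧ t.2.2 ∈ t.2.1 ∧
      ∀ᶠ m in 𝒰, t.2.2 + m ∈ t.2.1)
    (fun t t' => t.1 < t'.1 ∧ t.2.2 < t'.2.2 ∧ t'.2.1 ⊆ t.2.1 ∧
      ∀ m ∈ t'.2.1, t.2.2 + m ∈ t.2.1) (by
      intro S hS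
      let k := S.sup Prod.fst + 1
      let A : Set ℕ+ := {m | f m ∈ V k ∧ ∀ t ∈ S, t.2.2 < m ∧ m ∈ t.2.1 ∧ t.2.2 + m ∈ t.2.1}
      have hA : ∀ᶠ m in 𝒰, m ∈ A :=
        (show ∀ᶠ m : ℕ+ in 𝒰, f m ∈ V k from hV k).and (S.eventually_all.2 fun t ht =>
          (eventually_gt_of_idempotent h𝒰 t.2.2).and (Eventually.and (hS t ht).1 (hS t ht).2.2.2))
      obtain ⟨d, hd, hd'⟩ := (hA.and ((h𝒰 _).1 hA)).exists
      refine ⟨(k, A, d), ⟨hA, fun m hm => hm.1, hd, hd'⟩, fun t ht =>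
        ⟨Nat.lt_succ_of_le (Finset.le_sup (f := Prod.fst) ht), (hd.2 t ht).1,
          fun m hm => (hm.2 t ht).2.1, fun m hm => (hm.2 t ht).2.2⟩⟩)
  let d : ℕ → ℕ := fun n => (s n).2.2
  have hd : StrictMono d := fun a b hab => (hsr a b hab).2.1
  have hmono1 : StrictMono fun n => (s n).1 := fun a b hab => (hsr a b hab).1
  have hAanti : Antitone fun n => (s n).2.1 :=
    antitone_nat_of_succ_le fun n => (hsr n (n + 1) n.lt_succ_self).2.2.1
  -- Peel off the least index a: the remaining sum lies in the set of stage a + 1, and adding d a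
  -- moves it into that of stage a.
  have hsum : ∀ t : Finset ℕ, t.Nonempty → ∀ n, (∀ i ∈ t, n ≤ i) →
      ∃ m ∈ (s n).2.1, (m : ℕ) = ∑ i ∈ t, d i := by
    intro t
    induction t using Finset.induction_on_min with
    | empty => simp
    | insert a t hat ih =>
      intro _ n hn
      have hna : n ≤ a := hn a (by simp)
      rw [Finset.sum_insert fun h => (hat a h).false]
      rcases t.eq_empty_or_nonempty with rfl | ht
      · exact ⟨(s a).2.2, hAanti hna (hs a).2.2.1, by simp [d]⟩
      · obtain ⟨m, hm, hm'⟩ := ih ht (a + 1) fun i hi => hat i hi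
        exact ⟨(s a).2.2 + m, hAanti hna ((hsr a (a + 1) a.lt_succ_self).2.2.2 m hm),
          by rw [← hm']; rfl⟩
  refine ⟨Set.range d, Set.infinite_range_of_injective hd.injective, x, fun U hU => ?_⟩
  obtain ⟨n, hn⟩ := hVx U hU
  refine ⟨d '' Set.Iio n, (Set.finite_Iio n).image _, ?_⟩
  rintro _ ⟨_, ⟨S, hS, hSD, rfl⟩, rfl⟩
  have hidx : ∀ c ∈ S, ∃ i, n ≤ i ∧ d i = c := by
    intro c hc
    obtain ⟨⟨i, rfl⟩, hi⟩ := hSD hc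
    exact ⟨i, not_lt.1 fun h => hi ⟨i, h, rfl⟩, rfl⟩
  have hSt : S = (S.preimage d hd.injective.injOn).image d := by
    ext c
    simp only [Finset.mem_image, Finset.mem_preimage]
    refine ⟨fun hc => ?_, ?_⟩
    · obtain ⟨i, -, rfl⟩ := hidx c hc
      exact ⟨i, hc, rfl⟩
    · rintro ⟨i, hi, rfl⟩
      exact hi
  obtain ⟨m, hm, hm'⟩ := hsum (S.preimage d hd.injective.injOn)
    (by rw [hSt] at hS; exact Finset.image_nonempty.1 hS) n (by
      intro i hi
      obtain ⟨j, hj, hji⟩ := hidx _ (Finset.mem_preimage.1 hi)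
      exact hd.injective hji ▸ hj)
  rw [hSt, Finset.sum_image hd.injective.injOn, ← hm']
  exact hn (hanti hmono1.le_apply ((hs n).2.1 m hm))

/-- Differences of partial sums of an enumeration of D are finite sums of distinct elements of D. -/
theorem HindmanSpace.diffCompactSpace (hX : HindmanSpace X) : DiffCompactSpace X := by
  intro f
  obtain ⟨D, hD, x, hx⟩ := hX f
  let d := Nat.nth (· ∈ D)
  have hd : StrictMono d := Nat.nth_strictMono hD
  have hdD : ∀ n, d n ∈ D := Nat.nth_mem_of_infinite hD
  let e : ℕ → ℕ := fun n => ∑ i ∈ Finset.range (n + 1), d i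
  have he : StrictMono e := by
    refine strictMono_nat_of_lt_succ fun n => ?_
    have := (Nat.zero_le (d n)).trans_lt (hd n.lt_succ_self)
    have h := Finset.sum_range_succ d (n + 1)
    simp only [e, h]
    exact Nat.lt_add_of_pos_right this
  refine ⟨Set.range e, Set.infinite_range_of_injective he.injective, x, fun U hU => ?_⟩
  obtain ⟨K, hK, h⟩ := hx U hU
  -- For j ≥ N the difference e i - e j only uses indices from j + 1 on, all beyond those landing in
  -- K.
  obtain ⟨N, hN⟩ := (hK.preimage (f := d) hd.injective.injOn).bddAbove
  refine ⟨e '' Set.Iio N, (Set.finite_Iio N).image e, ?_⟩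
  rintro _ ⟨_, ⟨_, ⟨⟨i, rfl⟩, -⟩, _, ⟨⟨j, rfl⟩, hj⟩, hij, rfl⟩, rfl⟩
  have hjN : N ≤ j := not_lt.1 fun h => hj ⟨j, h, rfl⟩
  have hij : j < i := he.lt_iff_lt.1 hij
  refine h ⟨_, ⟨(Finset.Ico (j + 1) (i + 1)).image d, ?_, ?_, ?_⟩, rfl⟩
  · simpa using hij
  · intro c hc
    simp only [Finset.coe_image, Finset.coe_Ico] at hc
    obtain ⟨k, hk, rfl⟩ := hc
    refine ⟨hdD k, fun hkK => ?_⟩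
    have := hN hkK
    have := hk.1
    omega
  · rw [Finset.sum_image hd.injective.injOn]
    have := Finset.sum_range_add_sum_Ico d (show j + 1 ≤ i + 1 by omega)
    simp only [e]
    omega

end Hindman

/-! ### The dichotomy for maps with small fibres -/

section Ideals

variable {Λ : Type u} {I : Set (Set Λ)}

theorem IsIdealOn.empty_mem (hI : IsIdealOn I) : ∅ ∈ I := hI.finite_mem _ Set.finite_empty

theorem IsIdealOn.infinite_of_notMem (hI : IsIdealOn I) {B : Set Λ} (hB : B ∉ I) : B.Infinite :=
  fun h => hB (hI.finite_mem B h)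

theorem IsIdealOn.biUnion_mem (hI : IsIdealOn I) {ι : Type*} {s : Set ι} (hs : s.Finite)
    {g : ι → Set Λ} (hg : ∀ i ∈ s, g i ∈ I) : (⋃ i ∈ s, g i) ∈ I := by
  induction s, hs using Set.Finite.induction_on with
  | empty => simpa using hI.empty_mem
  | insert _ _ ih =>
    rw [Set.biUnion_insert]
    exact hI.union_mem _ _ (hg _ (Set.mem_insert _ _))
      (ih fun i hi => hg i (Set.mem_insert_of_mem _ hi))

theorem IsIdealOn.diff_notMem (hI : IsIdealOn I) {B C : Set Λ} (hB : B ∉ I) (hC : B ∩ C ∈ I) :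
    B \ C ∉ I := fun h => hB <| by
  rw [← Set.inter_union_sdiff B C]
  exact hI.union_mem _ _ hC h

/-- A map on `L` with fibres in `I` either is finite-to-one on some `I`-positive set whose image is
contained in a member of the countable cover `A` or almost disjoint from all of its members,
or `I` restricted to `L` is Katětov above `BI`. -/
theorem IsIdealOn.exists_finite_to_one_or_katetov [Countable Λ] (hI : IsIdealOn I) {L : Set Λ}
    {f : Λ → ℕ} (hf : ∀ n, L ∩ f ⁻¹' {n} ∈ I) {A : ℕ → Set ℕ} (hA : ∀ m, ∃ n, m ∈ A n) :
    (∃ B ⊆ L, B ∉ I ∧ (∀ n, (B ∩ f ⁻¹' {n}).Finite) ∧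
      ((∃ n, f '' B ⊆ A n) ∨ ∀ n, (f '' B ∩ A n).Finite)) ∨
    ∃ φ : Λ → ℕ × ℕ × ℕ, ∀ B ⊆ L, B ∉ I → φ '' B ∉ BI := by
  classical
  obtain ⟨ι, hι⟩ := exists_injective_nat Λ
  let r : ℕ → ℕ := fun m => Nat.find (hA m)
  have hr : ∀ m, m ∈ A (r m) := fun m => Nat.find_spec (hA m)
  have hr' : ∀ m n, m ∈ A n → r m ≤ n := fun m n h => Nat.find_min' (hA m) h
  rw [or_iff_not_imp_left]
  intro hno
  -- The first coordinate is the least index of a cover set containing f l; the injective last one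
  -- turns infinite fibres of f into infinite columns.
  refine ⟨fun l => (r (f l), f l, ι l), fun B hBL hB hBI => hno ?_⟩
  obtain ⟨k, h1, h2⟩ := hBI
  set C := (fun l => (r (f l), f l, ι l)) '' B with hC
  have hmemC : ∀ l ∈ B, (f l, ι l) ∈ sectionAt C (r (f l)) := fun l hl => ⟨l, hl, rfl⟩
  let S : Set ℕ := {m | (B ∩ f ⁻¹' {m}).Infinite}
  have hcol : ∀ m ∈ S, {y | (m, y) ∈ sectionAt C (r m)}.Infinite := by
    intro m hm
    refine (Set.Infinite.image hι.injOn hm).mono ?_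
    rintro _ ⟨l, ⟨hl, rfl⟩, rfl⟩
    exact hmemC l hl
  -- Sections from k on are finite and have no infinite column; each of the k earlier ones has
  -- finitely many.
  have hS : S.Finite := by
    have : (⋃ i ∈ Set.Iio k, {m | ¬ {y | (m, y) ∈ sectionAt C i}.Finite}).Finite :=
      (Set.finite_Iio k).biUnion fun i hi => h1 i hi
    refine this.subset fun m hm => ?_
    simp only [Set.mem_iUnion]
    refine ⟨r m, ?_, hcol m hm⟩
    by_contra hlt
    refine hcol m hm (((h2 (r m) (not_lt.1 hlt)).image Prod.snd).subset ?_)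
    exact fun y hy => ⟨(m, y), hy, rfl⟩
  have hBS : B \ f ⁻¹' S ∉ I := by
    refine hI.diff_notMem hB ?_
    rw [← Set.biUnion_of_singleton S, Set.preimage_iUnion₂, Set.inter_iUnion₂]
    exact hI.biUnion_mem hS fun m _ => hI.subset_mem _ _ (hf m) (by gcongr)
  have hfto : ∀ n, ((B \ f ⁻¹' S) ∩ f ⁻¹' {n}).Finite := by
    intro n
    by_cases hn : n ∈ S
    · refine Set.finite_empty.subset ?_
      rintro l ⟨⟨-, hl⟩, rfl⟩
      exact hl hn
    · exact (Set.not_infinite.1 hn).subset (by gcongr; exact Set.sdiff_subset)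
  by_cases hAi : ∃ i < k, (B \ f ⁻¹' S) ∩ f ⁻¹' A i ∉ I
  · obtain ⟨i, -, hi⟩ := hAi
    refine ⟨_, Set.inter_subset_left.trans (Set.sdiff_subset.trans hBL), hi,
      fun n => (hfto n).subset (by gcongr; exact Set.inter_subset_left), Or.inl ⟨i, ?_⟩⟩
    rintro _ ⟨l, hl, rfl⟩
    exact hl.2
  push Not at hAi
  -- After this removal, a value in A n has least index in [k, n], and only finitely many values
  -- occur there.
  refine ⟨(B \ f ⁻¹' S) \ ⋃ i ∈ Set.Iio k, f ⁻¹' A i,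
    Set.sdiff_subset.trans (Set.sdiff_subset.trans hBL), hI.diff_notMem hBS ?_,
    fun n => (hfto n).subset (Set.inter_subset_inter_left _ Set.sdiff_subset), Or.inr fun n => ?_⟩
  · rw [Set.inter_iUnion₂]
    exact hI.biUnion_mem (Set.finite_Iio k) hAi
  · have : (⋃ i ∈ Set.Icc k n, Prod.fst '' sectionAt C i).Finite :=
      (Set.finite_Icc k n).biUnion fun i hi => (h2 i hi.1).image _
    refine this.subset ?_
    rintro _ ⟨⟨l, ⟨⟨hlB, -⟩, hl⟩, rfl⟩, hn⟩
    simp only [Set.mem_iUnion]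
    refine ⟨r (f l), ⟨?_, hr' _ _ hn⟩, _, hmemC l hlB, rfl⟩
    by_contra hlt
    refine hl ?_
    simp only [Set.mem_iUnion]
    exact ⟨r (f l), not_le.1 hlt, hr _⟩

end Ideals

/-! ### Maximal almost disjoint families -/

section AlmostDisjoint

variable {Λ : Type u} {𝒜 : Set (Set Λ)}

theorem IsAlmostDisjointFamily.insert (h𝒜 : IsAlmostDisjointFamily 𝒜) {C : Set Λ}
    (hC : C.Infinite) (hCA : ∀ A ∈ 𝒜, (C ∩ A).Finite) : IsAlmostDisjointFamily (insert C 𝒜) := by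
  refine ⟨?_, ?_⟩
  · rintro A (rfl | hA)
    exacts [hC, h𝒜.1 A hA]
  · rintro A (rfl | hA) B (rfl | hB) hne
    · exact absurd rfl hne
    · exact hCA B hB
    · rw [Set.inter_comm]
      exact hCA A hA
    · exact h𝒜.2 A hA B hB hne

theorem IsMADFamily.exists_infinite_inter (h𝒜 : IsMADFamily 𝒜) {E : Set Λ} (hE : E.Infinite) :
    ∃ A ∈ 𝒜, (A ∩ E).Infinite := by
  by_contra! h
  have hle := h𝒜.2 (h𝒜.1.insert hE fun A hA => by rw [Set.inter_comm]; exact h A hA)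
    (Set.subset_insert E 𝒜)
  have := h E (hle (Set.mem_insert E 𝒜))
  rw [Set.inter_self] at this
  exact hE this

theorem IsAlmostDisjointFamily.exists_isMADFamily (h𝒜 : IsAlmostDisjointFamily 𝒜) :
    ∃ ℬ, 𝒜 ⊆ ℬ ∧ IsMADFamily ℬ := by
  refine zorn_subset_nonempty {ℬ | IsAlmostDisjointFamily ℬ} ?_ 𝒜 h𝒜
  intro c hc hchain _
  refine ⟨⋃₀ c, ⟨?_, ?_⟩, fun s hs => Set.subset_sUnion_of_mem hs⟩
  · rintro A ⟨ℬ, hℬ, hA⟩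
    exact (hc hℬ).1 A hA
  · rintro A ⟨ℬ, hℬ, hA⟩ B ⟨𝒞, h𝒞, hB⟩ hne
    rcases hchain.total hℬ h𝒞 with h | h
    · exact (hc h𝒞).2 A (h hA) B hB hne
    · exact (hc hℬ).2 A hA B (h hB) hne

/-- Diagonalise: pick from the n-th member a number at least n outside all earlier members. The
resulting set is almost disjoint from every member. -/
theorem IsMADFamily.not_countable {𝒜 : Set (Set ℕ)} (h𝒜 : IsMADFamily 𝒜) (hinf : 𝒜.Infinite) :
    ¬ 𝒜.Countable := by
  intro hc
  have := hc.to_subtype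
  have := hinf.to_subtype
  obtain ⟨e⟩ := nonempty_equiv_of_countable (α := ℕ) (β := 𝒜)
  have hex : ∀ n, ∃ c, c ∈ (e n : Set ℕ) ∧ n ≤ c ∧ ∀ i < n, c ∉ (e i : Set ℕ) := by
    intro n
    have hfin : (Set.Iio n ∪ ⋃ i ∈ Set.Iio n, (e n : Set ℕ) ∩ e i).Finite :=
      (Set.finite_Iio n).union ((Set.finite_Iio n).biUnion fun i hi =>
        h𝒜.1.2 _ (e n).2 _ (e i).2 fun h => (ne_of_lt hi).symm (e.injective (Subtype.ext h)))
    obtain ⟨c, hc, hc'⟩ := (h𝒜.1.1 _ (e n).2).exists_notMem_finite hfin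
    simp only [Set.mem_union, Set.mem_iUnion, not_or, not_exists] at hc'
    exact ⟨c, hc, not_lt.1 hc'.1, fun i hi hci => hc'.2 i hi ⟨hc, hci⟩⟩
  choose c hc hcn hci using hex
  have hinfc : (Set.range c).Infinite :=
    Set.infinite_of_forall_exists_gt fun n => ⟨c (n + 1), ⟨_, rfl⟩, hcn (n + 1)⟩
  obtain ⟨A, hA, hAc⟩ := h𝒜.exists_infinite_inter hinfc
  obtain ⟨i, hi⟩ := e.surjective ⟨A, hA⟩
  refine hAc (((Set.finite_Iic i).image c).subset ?_)
  rintro _ ⟨hx, n, rfl⟩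
  refine ⟨n, not_lt.1 fun hin => hci n i hin ?_, rfl⟩
  rw [hi]
  exact hx

end AlmostDisjoint

/-! ### Topology of Ψ(𝒜) and Φ(𝒜) -/

section Mrowka

variable {Λ : Type u} {𝒜 : Set (Set Λ)}

theorem MrowkaSpace.isOpen_iff {U : Set (MrowkaSpace 𝒜)} : IsOpen U ↔
    ∀ A : 𝒜, MrowkaSpace.member A ∈ U →
      ∃ F : Set Λ, F.Finite ∧ ∀ n ∈ (A : Set Λ) \ F, MrowkaSpace.point n ∈ U := Iff.rfl

/-- The clopen set `{A} ∪ (A \ F)`. -/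
def MrowkaSpace.basicSet (A : 𝒜) (F : Set Λ) : Set (MrowkaSpace 𝒜) :=
  insert (MrowkaSpace.member A) (MrowkaSpace.point '' ((A : Set Λ) \ F))

theorem MrowkaSpace.isOpen_basicSet (A : 𝒜) {F : Set Λ} (hF : F.Finite) :
    IsOpen (basicSet A F) := by
  rintro B (hB | ⟨n, -, hn⟩)
  · obtain rfl : B = A := by simpa using hB
    exact ⟨F, hF, fun n hn => Or.inr ⟨n, hn, rfl⟩⟩
  · cases hn

theorem MrowkaSpace.isOpen_singleton_point (n : Λ) :
    IsOpen {(MrowkaSpace.point n : MrowkaSpace 𝒜)} := by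
  intro A hA
  cases hA

theorem MrowkaSpace.tendsto_point (A : 𝒜) :
    Tendsto (fun n : (A : Set Λ) => (MrowkaSpace.point n.1 : MrowkaSpace 𝒜)) cofinite
      (𝓝 (MrowkaSpace.member A)) := by
  rw [tendsto_def]
  intro U hU
  obtain ⟨O, hOU, hO, hA⟩ := mem_nhds_iff.1 hU
  obtain ⟨F, hF, h⟩ := hO A hA
  rw [mem_cofinite]
  refine (hF.preimage Subtype.val_injective.injOn).subset fun n hn => ?_
  by_contra hnF
  exact hn (hOU (h n ⟨n.2, hnF⟩))

theorem MrowkaSpace.t2Space (h𝒜 : IsAlmostDisjointFamily 𝒜) : T2Space (MrowkaSpace 𝒜) := by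
  have hpm : ∀ (n : Λ) (A : 𝒜), ∃ U V : Set (MrowkaSpace 𝒜), IsOpen U ∧ IsOpen V ∧
      MrowkaSpace.point n ∈ U ∧ MrowkaSpace.member A ∈ V ∧ Disjoint U V := fun n A =>
    ⟨_, _, isOpen_singleton_point n, isOpen_basicSet A (Set.finite_singleton n), rfl, Or.inl rfl,
      by simp [basicSet]⟩
  refine ⟨fun x y hxy => ?_⟩
  rcases x with n | A <;> rcases y with m | B
  · exact ⟨_, _, isOpen_singleton_point n, isOpen_singleton_point m, rfl, rfl, by simpa using hxy⟩
  · exact hpm n B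
  · obtain ⟨U, V, hU, hV, h1, h2, h3⟩ := hpm m A
    exact ⟨V, U, hV, hU, h2, h1, h3.symm⟩
  · have hAB : (A : Set Λ) ≠ B := fun h => hxy (congrArg _ (Subtype.ext h))
    refine ⟨_, _, isOpen_basicSet A (h𝒜.2 A A.2 B B.2 hAB), isOpen_basicSet B Set.finite_empty,
      Or.inl rfl, Or.inl rfl, Set.disjoint_left.2 ?_⟩
    rintro _ (rfl | ⟨n, hn, rfl⟩) (h | ⟨m, hm, h⟩)
    · exact hxy h
    · cases h
    · cases h
    · cases h
      exact hn.2 ⟨hn.1, hm.1⟩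

theorem MrowkaSpace.isCompact_basicSet (A : 𝒜) : IsCompact (basicSet A ∅) := by
  convert (tendsto_point A).isCompact_insert_range_of_cofinite
  ext x
  simp [basicSet]

theorem MrowkaSpace.weaklyLocallyCompactSpace : WeaklyLocallyCompactSpace (MrowkaSpace 𝒜) := by
  refine ⟨fun x => ?_⟩
  rcases x with n | A
  · exact ⟨_, isCompact_singleton, (isOpen_singleton_point n).mem_nhds rfl⟩
  · exact ⟨_, isCompact_basicSet A,
      (isOpen_basicSet A Set.finite_empty).mem_nhds (Or.inl rfl)⟩

/-- Cover by the open sets {A} ∪ Λ, each containing a single member. -/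
theorem MrowkaSpace.finite_members_of_isCompact {K : Set (MrowkaSpace 𝒜)} (hK : IsCompact K) :
    {A : 𝒜 | MrowkaSpace.member A ∈ K}.Finite := by
  let U : 𝒜 → Set (MrowkaSpace 𝒜) := fun A =>
    insert (MrowkaSpace.member A) (Set.range MrowkaSpace.point)
  have hUo : ∀ A, IsOpen (U A) := fun A B _ => ⟨∅, Set.finite_empty, fun n _ => Or.inr ⟨n, rfl⟩⟩
  rcases isEmpty_or_nonempty 𝒜 with h | ⟨⟨A₀⟩⟩
  · exact Set.toFinite _
  obtain ⟨t, ht⟩ := hK.elim_finite_subcover U hUo (by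
    rintro (n | A) -
    · exact Set.mem_iUnion.2 ⟨A₀, Or.inr ⟨n, rfl⟩⟩
    · exact Set.mem_iUnion.2 ⟨A, Or.inl rfl⟩)
  refine t.finite_toSet.subset fun A hA => ?_
  obtain ⟨B, hB, h⟩ := Set.mem_iUnion₂.1 (ht hA)
  rcases h with h | ⟨n, hn⟩
  · cases h
    exact hB
  · cases hn

theorem FranklinSpace.t2Space (h𝒜 : IsAlmostDisjointFamily 𝒜) : T2Space (FranklinSpace 𝒜) := by
  have := MrowkaSpace.t2Space h𝒜
  have := MrowkaSpace.weaklyLocallyCompactSpace (𝒜 := 𝒜)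
  infer_instance

theorem FranklinSpace.tendsto_member {ι : Type*} {l : Filter ι} {A : 𝒜} {g : ι → Λ}
    (hg : ∀ᶠ i in l, g i ∈ (A : Set Λ)) (hfin : Tendsto g l cofinite) :
    Tendsto (fun i => ((MrowkaSpace.point (g i) : MrowkaSpace 𝒜) : FranklinSpace 𝒜)) l
      (𝓝 ((MrowkaSpace.member A : MrowkaSpace 𝒜) : FranklinSpace 𝒜)) := by
  refine (OnePoint.continuous_coe.tendsto (MrowkaSpace.member A)).comp ?_
  rw [tendsto_def]
  intro U hU
  obtain ⟨O, hOU, hO, hA⟩ := mem_nhds_iff.1 hU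
  obtain ⟨F, hF, h⟩ := hO A hA
  filter_upwards [hg, hfin hF.compl_mem_cofinite] with i hi hi'
  exact hOU (h _ ⟨hi, hi'⟩)

theorem FranklinSpace.separableSpace [Countable Λ] (h𝒜 : IsAlmostDisjointFamily 𝒜) :
    TopologicalSpace.SeparableSpace (FranklinSpace 𝒜) := by
  refine ⟨insert OnePoint.infty (Set.range fun n : Λ => ((MrowkaSpace.point n : MrowkaSpace 𝒜) :
    FranklinSpace 𝒜)), (Set.countable_range _).insert _, fun x => ?_⟩
  induction x using OnePoint.rec with
  | infty => exact subset_closure (Or.inl rfl)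
  | coe x =>
    rcases x with n | A
    · exact subset_closure (Or.inr ⟨n, rfl⟩)
    · have := (h𝒜.1 A A.2).to_subtype
      refine mem_closure_of_tendsto (tendsto_member (A := A)
        (g := fun n : (A : Set Λ) => n.1) (l := cofinite) (Eventually.of_forall fun n => n.2)
        Subtype.val_injective.tendsto_cofinite) (Eventually.of_forall fun n => Or.inr ⟨_, rfl⟩)

theorem FranklinSpace.mk_eq_continuum (hCH : Cardinal.continuum.{0} = Cardinal.aleph.{0} 1)
    {𝒜 : Set (Set ℕ)} (h𝒜 : IsMADFamily 𝒜) (hinf : 𝒜.Infinite) :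
    Cardinal.mk (FranklinSpace 𝒜) = Cardinal.continuum := by
  refine le_antisymm ?_ ?_
  · let g : Option (ℕ ⊕ Set ℕ) → FranklinSpace 𝒜 := fun o => match o with
      | none => OnePoint.infty
      | some (Sum.inl n) => ((MrowkaSpace.point n : MrowkaSpace 𝒜) : FranklinSpace 𝒜)
      | some (Sum.inr A) => open Classical in if h : A ∈ 𝒜 then
          ((MrowkaSpace.member ⟨A, h⟩ : MrowkaSpace 𝒜) : FranklinSpace 𝒜) else OnePoint.infty
    have hg : g.Surjective := by
      intro x
      induction x using OnePoint.rec with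
      | infty => exact ⟨none, rfl⟩
      | coe x =>
        rcases x with n | A
        · exact ⟨some (Sum.inl n), rfl⟩
        · exact ⟨some (Sum.inr A), by simp [g]⟩
    refine (Cardinal.mk_le_of_surjective hg).trans ?_
    simp [Cardinal.mk_option, Cardinal.add_one_eq Cardinal.aleph0_le_continuum]
  · rw [hCH, ← Cardinal.succ_aleph0, Order.succ_le_iff]
    have h1 : Cardinal.aleph0 < Cardinal.mk 𝒜 := by
      rw [← not_le, Cardinal.le_aleph0_iff_set_countable]
      exact h𝒜.not_countable hinf
    refine h1.trans_le (Cardinal.mk_le_of_injective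
      (f := fun A : 𝒜 => ((MrowkaSpace.member A : MrowkaSpace 𝒜) : FranklinSpace 𝒜)) ?_)
    intro A B h
    simpa using h

end Mrowka

/-! ### Differences and 2-adic valuation -/

section Valuation

/-- The numbers with `2`-adic valuation `a`. -/
def valuationClass (a : ℕ) : Set ℕ := {n | padicValNat 2 n = a}

theorem valuationClass_infinite (a : ℕ) : (valuationClass a).Infinite := by
  refine Set.infinite_of_injective_forall_mem (f := fun k : ℕ => 2 ^ a * (2 * k + 1)) ?_ ?_
  · intro k l h
    have := Nat.eq_of_mul_eq_mul_left (by positivity) h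
    omega
  · intro k
    change padicValNat 2 _ = a
    rw [padicValNat.mul (by positivity) (by omega), padicValNat.prime_pow,
      padicValNat.eq_zero_of_not_dvd (by omega), add_zero]

theorem isAlmostDisjointFamily_range_valuationClass :
    IsAlmostDisjointFamily (Set.range valuationClass) := by
  refine ⟨?_, ?_⟩
  · rintro _ ⟨a, rfl⟩
    exact valuationClass_infinite a
  · rintro _ ⟨a, rfl⟩ _ ⟨b, rfl⟩ hne
    refine Set.finite_empty.subset ?_
    rintro n ⟨ha, hb⟩
    exact hne (congrArg _ (ha.symm.trans hb))

theorem valuationClass_injective : valuationClass.Injective := by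
  intro a b h
  obtain ⟨n, hn⟩ := (valuationClass_infinite a).nonempty
  exact hn.symm.trans (show n ∈ valuationClass b from h ▸ hn)

/-- The sum of two odd numbers is even. -/
theorem padicValNat_two_add_ne {m n : ℕ} (hm : m ≠ 0) (hn : n ≠ 0)
    (h : padicValNat 2 m = padicValNat 2 n) : padicValNat 2 (m + n) ≠ padicValNat 2 m := by
  intro h'
  have h1 : ∀ k ≠ 0, padicValNat 2 k = padicValNat 2 m →
      ∃ c, k = 2 ^ padicValNat 2 m * (2 * c + 1) := by
    intro k hk hkm
    obtain ⟨c, hc⟩ := (padicValNat_dvd_iff_le (p := 2) hk).2 hkm.ge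
    have h2 := (padicValNat_dvd_iff_le (p := 2) (n := padicValNat 2 m + 1) hk).not.2 (by omega)
    rcases Nat.even_or_odd' c with ⟨d, rfl | rfl⟩
    · exact absurd ⟨d, by rw [hc, pow_succ]; ring⟩ h2
    · exact ⟨d, hc⟩
  obtain ⟨a, ha⟩ := h1 m hm rfl
  obtain ⟨b, hb⟩ := h1 n hn h.symm
  obtain ⟨c, hc⟩ := h1 (m + n) (by omega) h'
  have h3 : 2 ^ padicValNat 2 m * (2 * a + 1 + (2 * b + 1)) =
      2 ^ padicValNat 2 m * (2 * c + 1) := by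
    rw [mul_add, ← ha, ← hb, ← hc]
  have := Nat.eq_of_mul_eq_mul_left (by positivity) h3
  omega

theorem padicValNat_two_sub_eq {m n : ℕ} (hm : m ≠ 0) (hmn : m < n)
    (h : padicValNat 2 m < padicValNat 2 n) : padicValNat 2 (n - m) = padicValNat 2 m := by
  have hnm : n - m ≠ 0 := by omega
  have hm' := (padicValNat_dvd_iff_le (p := 2) hm).2 le_rfl
  have hn' := fun k => padicValNat_dvd_iff_le (p := 2) (n := k) (show n ≠ 0 by omega)
  refine le_antisymm (not_lt.1 fun hlt => ?_) ?_
  · have h1 := (padicValNat_dvd_iff_le (p := 2) hnm).2 (Nat.succ_le_of_lt hlt)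
    have h2 := (Nat.dvd_sub_iff_right hmn.le ((hn' _).2 (Nat.succ_le_of_lt h))).1 h1
    have := (padicValNat_dvd_iff_le (p := 2) hm).1 h2
    omega
  · exact (padicValNat_dvd_iff_le (p := 2) hnm).1 (Nat.dvd_sub ((hn' _).2 h.le) hm')

theorem not_posDiffs_subset_valuationClass {F : Set ℕ} (hF : F.Infinite) (a : ℕ) :
    ¬ posDiffs F ⊆ valuationClass a := by
  intro h
  obtain ⟨x, hx⟩ := hF.nonempty
  obtain ⟨y, hy, hxy⟩ := hF.exists_gt x
  obtain ⟨z, hz, hyz⟩ := hF.exists_gt y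
  have h1 : padicValNat 2 (y - x) = a := h ⟨y, hy, x, hx, hxy, rfl⟩
  have h2 : padicValNat 2 (z - y) = a := h ⟨z, hz, y, hy, hyz, rfl⟩
  have h3 : padicValNat 2 (z - x) = a := h ⟨z, hz, x, hx, hxy.trans hyz, rfl⟩
  refine padicValNat_two_add_ne (m := y - x) (n := z - y) (by omega) (by omega)
    (h1.trans h2.symm) ?_
  rw [show y - x + (z - y) = z - x by omega, h1, h3]

/-- Fix x < y in F and let b be the valuation of y - x. If no class were met infinitely, e - x would
have valuation above b for almost all e ∈ F, forcing e - y to have valuation exactly b. -/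
theorem exists_infinite_posDiffs_inter_valuationClass {F : Set ℕ} (hF : F.Infinite) :
    ∃ a, (posDiffs F ∩ valuationClass a).Infinite := by
  obtain ⟨x, hx⟩ := hF.nonempty
  obtain ⟨y, hy, hxy⟩ := hF.exists_gt x
  have key : ∀ d ∈ F, ∀ a, {e ∈ F | d < e ∧ padicValNat 2 (e - d) = a}.Infinite →
      (posDiffs F ∩ valuationClass a).Infinite := by
    intro d hd a hinf
    refine (hinf.image (f := fun e => e - d) ?_).mono ?_
    · intro e he e' he' h
      have := he.2.1
      have := he'.2.1
      simp only at h
      omega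
    · rintro _ ⟨e, he, rfl⟩
      exact ⟨⟨e, he.1, d, hd, he.2.1, rfl⟩, he.2.2⟩
  by_contra! hno
  set b := padicValNat 2 (y - x) with hb
  have h1 : ∀ a, {e ∈ F | x < e ∧ padicValNat 2 (e - x) = a}.Finite := fun a => by
    by_contra h
    exact key x hx a h (hno a)
  have h2 : {e ∈ F | y < e ∧ padicValNat 2 (e - y) = b}.Finite := by
    by_contra h
    exact key y hy b h (hno b)
  refine hF ((((Set.finite_Iic b).biUnion fun a _ => h1 a).union
    (h2.union (Set.finite_Iic y))).subset fun e he => ?_)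
  by_cases hye : e ≤ y
  · exact Or.inr (Or.inr hye)
  have hye := not_le.1 hye
  by_cases hv : padicValNat 2 (e - x) ≤ b
  · left
    simp only [Set.mem_iUnion]
    exact ⟨_, hv, he, hxy.trans hye, rfl⟩
  · right
    left
    refine ⟨he, hye, ?_⟩
    rw [show e - y = e - x - (y - x) by omega]
    exact padicValNat_two_sub_eq (by omega) (by omega) (not_le.1 hv)

end Valuation

/-! ### Failure of differential compactness -/

section NotDiffCompact

theorem FranklinSpace.not_diffCompactSpace {𝒜 : Set (Set ℕ)} (h𝒜 : IsMADFamily 𝒜)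
    (hval : ∀ a, valuationClass a ∈ 𝒜) : ¬ DiffCompactSpace (FranklinSpace 𝒜) := by
  intro hX
  have := FranklinSpace.t2Space h𝒜.1
  obtain ⟨F, hF, x, hx⟩ :=
    hX fun n => ((MrowkaSpace.point n : MrowkaSpace 𝒜) : FranklinSpace 𝒜)
  let e := Nat.nth (· ∈ F)
  have he : StrictMono e := Nat.nth_strictMono hF
  have heF : ∀ n, e n ∈ F := Nat.nth_mem_of_infinite hF
  -- Both endpoints tend to infinity, so these differences escape every finite K, and the gap makes
  -- them unbounded. By maximality some A captures infinitely many, which identifies the limit.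
  let v : ℕ → ℕ := fun n => e (2 * n + 1) - e n
  have hgap : ∀ n k, e n + k ≤ e (n + k) := by
    intro n k
    induction k with
    | zero => rfl
    | succ k ih =>
      have := he (Nat.lt_succ_self (n + k))
      simp only [Nat.succ_eq_add_one, ← add_assoc] at *
      omega
  have hv : ∀ n, n < v n := fun n => by
    have := hgap n (n + 1)
    rw [show n + (n + 1) = 2 * n + 1 by ring] at this
    simp only [v]
    omega
  obtain ⟨A, hA, hinf⟩ := h𝒜.exists_infinite_inter (E := Set.range v)
    (Set.infinite_of_forall_exists_gt fun n => ⟨v n, ⟨n, rfl⟩, hv n⟩)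
  have hN : (v ⁻¹' A).Infinite := fun h =>
    hinf ((h.image v).subset (by rintro _ ⟨hn, n, rfl⟩; exact ⟨n, hn, rfl⟩))
  let l : Filter ℕ := cofinite ⊓ 𝓟 (v ⁻¹' A)
  have hl : l.NeBot := by
    rw [inf_principal_neBot_iff]
    intro s hs
    by_contra h
    rw [Set.not_nonempty_iff_eq_empty] at h
    refine hN (Set.Finite.subset hs fun n hn hns => ?_)
    exact (h ▸ (⟨hns, hn⟩ : n ∈ s ∩ v ⁻¹' A) : n ∈ (∅ : Set ℕ))
  have hvtend : Tendsto v l cofinite := by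
    refine Tendsto.mono_left ?_ inf_le_left
    rw [Nat.cofinite_eq_atTop]
    exact tendsto_atTop_mono (fun n => (hv n).le) tendsto_id
  have hlimA := FranklinSpace.tendsto_member (𝒜 := 𝒜) (A := ⟨A, hA⟩) (l := l) (g := v)
    (mem_inf_of_right (mem_principal_self _)) hvtend
  have hlimx : Tendsto (fun n => ((MrowkaSpace.point (v n) : MrowkaSpace 𝒜) : FranklinSpace 𝒜)) l
      (𝓝 x) := by
    rw [tendsto_def]
    intro U hU
    obtain ⟨K, hK, hKU⟩ := hx U hU
    have hinj : (fun n => e (2 * n + 1)).Injective := fun a b h => by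
      have := he.injective h
      omega
    have h1 : ∀ᶠ n in cofinite, e n ∉ K ∧ e (2 * n + 1) ∉ K :=
      (he.injective.tendsto_cofinite.eventually hK.compl_mem_cofinite).and
        (hinj.tendsto_cofinite.eventually hK.compl_mem_cofinite)
    refine mem_inf_of_left ?_
    filter_upwards [h1] with n hn
    exact hKU ⟨v n, ⟨_, ⟨heF _, hn.2⟩, _, ⟨heF n, hn.1⟩, he (by omega), rfl⟩, rfl⟩
  obtain rfl := tendsto_nhds_unique hlimx hlimA
  obtain ⟨K, hK, hKU⟩ := hx _ ((OnePoint.isOpenMap_coe _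
    (MrowkaSpace.isOpen_basicSet ⟨A, hA⟩ Set.finite_empty)).mem_nhds ⟨_, Or.inl rfl, rfl⟩)
  have hsub : posDiffs (F \ K) ⊆ A := by
    intro d hd
    obtain ⟨y, hy, hyd⟩ := hKU ⟨d, hd, rfl⟩
    obtain rfl := OnePoint.coe_injective hyd
    rcases hy with hy | ⟨m, hm, hy⟩
    · cases hy
    · cases hy
      exact hm.1
  have hFK : (F \ K).Infinite := hF.sdiff hK
  obtain ⟨a, ha⟩ := exists_infinite_posDiffs_inter_valuationClass hFK
  by_cases hAa : A = valuationClass a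
  · exact not_posDiffs_subset_valuationClass hFK a (hAa ▸ hsub)
  · exact ha ((h𝒜.1.2 A hA _ (hval a) hAa).subset (Set.inter_subset_inter_left _ hsub))

end NotDiffCompact

/-! ### Construction of the family under CH -/

section Construction

/-- Every map `f : L → ω` with fibres in `I` is finite-to-one on some `I`-positive set whose image is
contained in a member of `𝒜`, unless `I` restricted to `L` is Katětov above `BI`. -/
def CapturesMaps {Λ : Type u} (I : Set (Set Λ)) (𝒜 : Set (Set ℕ)) : Prop :=
  ∀ (L : Set Λ) (f : Λ → ℕ), (∀ n, L ∩ f ⁻¹' {n} ∈ I) →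
    (∃ B ⊆ L, B ∉ I ∧ (∀ n, (B ∩ f ⁻¹' {n}).Finite) ∧ ∃ A ∈ 𝒜, f '' B ⊆ A) ∨
    ∃ φ : Λ → ℕ × ℕ × ℕ, ∀ B ⊆ L, B ∉ I → φ '' B ∉ BI

variable {Λ : Type u}

theorem exists_wellOrder_countable_initial_segments
    (hCH : Cardinal.continuum.{0} = Cardinal.aleph.{0} 1) [Countable Λ] [Infinite Λ] :
    ∃ r : Set Λ × (Λ → ℕ) → Set Λ × (Λ → ℕ) → Prop, IsWellOrder _ r ∧
      ∀ t, {s | r s t}.Countable := by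
  have hCHu : Cardinal.continuum.{u} = Cardinal.aleph.{u} 1 := by
    simpa using congrArg Cardinal.lift.{u} hCH
  have hcard : Cardinal.mk (Set Λ × (Λ → ℕ)) = Cardinal.aleph.{u} 1 := by
    rw [← hCHu]
    simp [Cardinal.mk_prod, Cardinal.mk_set]
  obtain ⟨r, hwo, hr⟩ := Cardinal.exists_ord_eq (Set Λ × (Λ → ℕ))
  refine ⟨r, hwo, fun t => ?_⟩
  have := Cardinal.card_typein_lt t hr
  rw [hcard, ← Cardinal.succ_aleph0, Order.lt_succ_iff] at this
  rw [← Cardinal.le_aleph0_iff_set_countable]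
  exact this

/-- Transfinite construction of an almost disjoint family: if every countable almost disjoint family
containing `ℰ` can be enlarged by countably many sets so as to satisfy the requirement `t`, then all
the requirements, one for each element of a well-order with countable initial segments, can be
met at once. -/
theorem exists_almostDisjointFamily_of_extensions {T : Type*} {r : T → T → Prop} [IsWellOrder T r]
    (hr : ∀ t, {s | r s t}.Countable) {ℰ : Set (Set ℕ)} (hℰc : ℰ.Countable)
    (hℰ : IsAlmostDisjointFamily ℰ) {Q : T → Set (Set ℕ) → Prop}
    (hQmono : ∀ t 𝒜 ℬ, 𝒜 ⊆ ℬ → Q t 𝒜 → Q t ℬ)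
    (hQ : ∀ t 𝒜, ℰ ⊆ 𝒜 → 𝒜.Countable → IsAlmostDisjointFamily 𝒜 →
      ∃ 𝒞 : Set (Set ℕ), 𝒞.Countable ∧ IsAlmostDisjointFamily (𝒜 ∪ 𝒞) ∧ Q t (𝒜 ∪ 𝒞)) :
    ∃ 𝒜, ℰ ⊆ 𝒜 ∧ IsAlmostDisjointFamily 𝒜 ∧ ∀ t, Q t 𝒜 := by
  have hwf : WellFounded r := IsWellFounded.wf
  choose! G hGc hGad hGQ using hQ
  let C : T → Set (Set ℕ) := hwf.fix fun t ih => G t (ℰ ∪ ⋃ s : {s // r s t}, ih s.1 s.2)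
  let 𝒟 : T → Set (Set ℕ) := fun t => ℰ ∪ ⋃ s : {s // r s t}, C s.1
  have hC : ∀ t, C t = G t (𝒟 t) := fun t => hwf.fix_eq _ t
  have hsub : ∀ t, ℰ ⊆ 𝒟 t := fun t => Set.subset_union_left
  have hCD : ∀ s t, r s t → 𝒟 s ∪ C s ⊆ 𝒟 t := by
    intro s t hst
    refine Set.union_subset (Set.union_subset_union_right _ ?_) ?_
    · exact Set.iUnion_subset fun a => Set.subset_iUnion (fun a : {a // r a t} => C a.1)
        ⟨a.1, _root_.trans a.2 hst⟩
    · exact (Set.subset_iUnion (fun a : {a // r a t} => C a.1) ⟨s, hst⟩).trans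
        Set.subset_union_right
  have hinv : ∀ t, (𝒟 t).Countable ∧ IsAlmostDisjointFamily (𝒟 t) := by
    intro t
    induction t using hwf.induction with
    | _ t ih =>
      have hc : (𝒟 t).Countable := by
        have := (hr t).to_subtype
        have : Countable {s // r s t} := this
        refine hℰc.union (Set.countable_iUnion fun s => ?_)
        rw [hC]
        exact hGc _ _ (hsub _) (ih s.1 s.2).1 (ih s.1 s.2).2
      refine ⟨hc, ?_⟩
      have hstep : ∀ s, r s t → IsAlmostDisjointFamily (𝒟 s ∪ C s) := fun s hs => by
        rw [hC]
        exact hGad _ _ (hsub _) (ih s hs).1 (ih s hs).2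
      -- Two members then both belong to the later of their stages, which is almost disjoint by
      -- induction.
      have hone : ∀ A ∈ 𝒟 t, A ∈ ℰ ∨ ∃ s, r s t ∧ A ∈ 𝒟 s ∪ C s := by
        rintro A (h | h)
        · exact Or.inl h
        · obtain ⟨s, hs⟩ := Set.mem_iUnion.1 h
          exact Or.inr ⟨s.1, s.2, Or.inr hs⟩
      refine ⟨fun A hA => ?_, fun A hA B hB hne => ?_⟩
      · rcases hone A hA with h | ⟨s, hs, h⟩
        exacts [hℰ.1 A h, (hstep s hs).1 A h]
      · rcases hone A hA with hA | ⟨s, hs, hA⟩ <;> rcases hone B hB with hB | ⟨s', hs', hB⟩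
        · exact hℰ.2 A hA B hB hne
        · exact (hstep s' hs').2 A (Or.inl (hsub _ hA)) B hB hne
        · exact (hstep s hs).2 A hA B (Or.inl (hsub _ hB)) hne
        · rcases trichotomous_of r s s' with h | rfl | h
          · exact (hstep s' hs').2 A (Or.inl (hCD _ _ h hA)) B hB hne
          · exact (hstep s hs).2 A hA B hB hne
          · exact (hstep s hs).2 A hA B (Or.inl (hCD _ _ h hB)) hne
  have hstep : ∀ t, IsAlmostDisjointFamily (𝒟 t ∪ C t) := fun t => by
    rw [hC]
    exact hGad _ _ (hsub _) (hinv t).1 (hinv t).2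
  refine ⟨ℰ ∪ ⋃ t, (𝒟 t ∪ C t), Set.subset_union_left, ⟨?_, ?_⟩, fun t => ?_⟩
  · rintro A (hA | hA)
    · exact hℰ.1 A hA
    · obtain ⟨t, ht⟩ := Set.mem_iUnion.1 hA
      exact (hstep t).1 A ht
  · have : ∀ A ∈ ⋃ t, (𝒟 t ∪ C t), ∀ B ∈ ℰ ∪ ⋃ t, (𝒟 t ∪ C t), A ≠ B → (A ∩ B).Finite := by
      intro A hA B hB hne
      obtain ⟨s, hs⟩ := Set.mem_iUnion.1 hA
      rcases hB with hB | hB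
      · exact (hstep s).2 A hs B (Or.inl (hsub _ hB)) hne
      obtain ⟨t, ht⟩ := Set.mem_iUnion.1 hB
      rcases trichotomous_of r s t with h | rfl | h
      · exact (hstep t).2 A (Or.inl (hCD _ _ h hs)) B ht hne
      · exact (hstep s).2 A hs B ht hne
      · exact (hstep s).2 A hs B (Or.inl (hCD _ _ h ht)) hne
    rintro A (hA | hA) B hB hne
    · rcases hB with hB | hB
      · exact hℰ.2 A hA B hB hne
      · rw [Set.inter_comm]
        exact this B hB A (Or.inl hA) hne.symm
    · exact this A hA B hB hne
  · refine hQmono t (𝒟 t ∪ C t) _ ((Set.subset_iUnion (fun t => 𝒟 t ∪ C t) t).trans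
      Set.subset_union_right) ?_
    rw [hC]
    exact hGQ _ _ (hsub _) (hinv t).1 (hinv t).2

theorem exists_isMADFamily_capturesMaps
    (hCH : Cardinal.continuum.{0} = Cardinal.aleph.{0} 1) [Countable Λ] [Infinite Λ]
    {I : Set (Set Λ)} (hI : IsIdealOn I) :
    ∃ 𝒜 : Set (Set ℕ), IsMADFamily 𝒜 ∧ (∀ a, valuationClass a ∈ 𝒜) ∧ CapturesMaps I 𝒜 := by
  obtain ⟨r, hwo, hr⟩ := exists_wellOrder_countable_initial_segments (Λ := Λ) hCH
  obtain ⟨𝒜, hℰ, h𝒜, hQ⟩ := exists_almostDisjointFamily_of_extensions hr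
    (Set.countable_range valuationClass) isAlmostDisjointFamily_range_valuationClass
    (Q := fun t 𝒜 => (∀ n, t.1 ∩ t.2 ⁻¹' {n} ∈ I) →
      (∃ B ⊆ t.1, B ∉ I ∧ (∀ n, (B ∩ t.2 ⁻¹' {n}).Finite) ∧ ∃ A ∈ 𝒜, t.2 '' B ⊆ A) ∨
      ∃ φ : Λ → ℕ × ℕ × ℕ, ∀ B ⊆ t.1, B ∉ I → φ '' B ∉ BI)
    (by
      intro t 𝒜 ℬ h hQ hf
      refine (hQ hf).imp_left ?_
      rintro ⟨B, hBL, hB, hfto, A, hA, hBA⟩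
      exact ⟨B, hBL, hB, hfto, A, h hA, hBA⟩)
    (by
      rintro ⟨L, f⟩ 𝒜 hℰ h𝒜c h𝒜
      by_cases hf : ∀ n, L ∩ f ⁻¹' {n} ∈ I
      swap
      · exact ⟨∅, Set.countable_empty, by simpa using h𝒜, fun h => absurd h hf⟩
      obtain ⟨A, rfl⟩ := h𝒜c.exists_eq_range ⟨_, hℰ ⟨0, rfl⟩⟩
      -- The valuation classes cover ω; 0 falls into class 0 by the default value of `padicValNat`.
      have hcov : ∀ m, ∃ n, m ∈ A n := by
        intro m
        obtain ⟨n, hn⟩ := hℰ ⟨padicValNat 2 m, rfl⟩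
        exact ⟨n, by rw [hn]; rfl⟩
      rcases hI.exists_finite_to_one_or_katetov hf hcov with
        ⟨B, hBL, hB, hfto, ⟨n, hn⟩ | had⟩ | hφ
      · exact ⟨∅, Set.countable_empty, by simpa using h𝒜,
          fun _ => Or.inl ⟨B, hBL, hB, hfto, A n, Or.inl ⟨n, rfl⟩, hn⟩⟩
      -- The only case that adds a set: the image is infinite because B is infinite and the fibres
      -- are finite.
      · refine ⟨{f '' B}, Set.countable_singleton _, ?_,
          fun _ => Or.inl ⟨B, hBL, hB, hfto, f '' B, Or.inr rfl, subset_rfl⟩⟩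
        rw [Set.union_singleton]
        refine h𝒜.insert (fun hfin => hI.infinite_of_notMem hB ?_) (by rintro _ ⟨n, rfl⟩; exact had n)
        refine (hfin.biUnion fun n _ => hfto n).subset fun l hl => ?_
        exact Set.mem_biUnion (Set.mem_image_of_mem f hl) ⟨hl, rfl⟩
      · exact ⟨∅, Set.countable_empty, by simpa using h𝒜, fun _ => Or.inr hφ⟩)
  obtain ⟨ℬ, h𝒜ℬ, hℬ⟩ := h𝒜.exists_isMADFamily
  refine ⟨ℬ, hℬ, fun a => h𝒜ℬ (hℰ ⟨a, rfl⟩), fun L f hf => (hQ (L, f) hf).imp_left ?_⟩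
  rintro ⟨B, hBL, hB, hfto, A, hA, hBA⟩
  exact ⟨B, hBL, hB, hfto, A, h𝒜ℬ hA, hBA⟩

theorem FranklinSpace.finBW [Countable Λ] {I : Set (Set Λ)} (hI : IsIdealOn I)
    (hBI : ¬ KatetovLE BI I) {𝒜 : Set (Set ℕ)} (hcap : CapturesMaps I 𝒜) : FinBW I (FranklinSpace 𝒜) := by
  classical
  intro f
  by_cases hfib : ∃ x, f ⁻¹' {x} ∉ I
  · obtain ⟨x, hx⟩ := hfib
    refine ⟨_, hx, x, tendsto_domRestrict_cofinite_iff.2 fun U hU => ?_⟩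
    refine Set.finite_empty.subset ?_
    rintro a ⟨rfl, ha⟩
    exact ha (mem_of_mem_nhds hU)
  push Not at hfib
  let pt : ℕ → FranklinSpace 𝒜 := fun n => ((MrowkaSpace.point n : MrowkaSpace 𝒜) : FranklinSpace 𝒜)
  let L : Set Λ := f ⁻¹' Set.range pt
  let g : Λ → ℕ := fun l => Function.invFun pt (f l)
  have hg : ∀ l ∈ L, pt (g l) = f l := fun l hl => Function.invFun_eq hl
  have hgfib : ∀ n, L ∩ g ⁻¹' {n} ∈ I := fun n => by
    refine hI.subset_mem _ _ (hfib (pt n)) ?_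
    rintro l ⟨hl, rfl⟩
    exact (hg l hl).symm
  rcases hcap L g hgfib with ⟨B, hBL, hB, hfto, A, hA, hBA⟩ | ⟨φ, hφ⟩
  · refine ⟨B, hB, ((MrowkaSpace.member ⟨A, hA⟩ : MrowkaSpace 𝒜) : FranklinSpace 𝒜), ?_⟩
    have := FranklinSpace.tendsto_member (𝒜 := 𝒜) (A := ⟨A, hA⟩) (g := B.domRestrict g)
      (l := cofinite) (Eventually.of_forall fun l => hBA ⟨l, l.2, rfl⟩)
      (Tendsto.cofinite_of_finite_preimage_singleton fun n => by
        refine Set.Finite.of_finite_image ((hfto n).subset ?_) Subtype.val_injective.injOn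
        rintro _ ⟨l, hl, rfl⟩
        exact ⟨l.2, hl⟩)
    refine this.congr fun l => hg l (hBL l.2)
  obtain ⟨ν, hν⟩ := Set.countable_iff_exists_injOn.1 (Set.countable_range f)
  have hνfib : ∀ n, Lᶜ ∩ (ν ∘ f) ⁻¹' {n} ∈ I := by
    intro n
    by_cases hn : ∃ l, ν (f l) = n
    · obtain ⟨l, rfl⟩ := hn
      refine hI.subset_mem _ _ (hfib (f l)) ?_
      rintro a ⟨-, ha⟩
      exact hν ⟨a, rfl⟩ ⟨l, rfl⟩ ha
    · refine hI.subset_mem _ _ hI.empty_mem ?_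
      rintro a ⟨-, ha⟩
      exact hn ⟨a, ha⟩
  -- Off L the values lie in 𝒜 ∪ {∞}, so being finite-to-one already gives convergence to ∞, since
  -- compact sets contain finitely many members. The cover is therefore trivial.
  rcases hI.exists_finite_to_one_or_katetov hνfib (A := fun _ => Set.univ)
    (fun m => ⟨0, Set.mem_univ m⟩) with ⟨B, hBL, hB, hfto, -⟩ | ⟨ψ, hψ⟩
  · refine ⟨B, hB, OnePoint.infty, tendsto_domRestrict_cofinite_iff.2 fun U hU => ?_⟩
    obtain ⟨K, ⟨-, hK⟩, hKU⟩ := OnePoint.hasBasis_nhds_infty.mem_iff.1 hU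
    refine ((MrowkaSpace.finite_members_of_isCompact hK).biUnion fun A _ =>
      hfto (ν ((MrowkaSpace.member A : MrowkaSpace 𝒜) : FranklinSpace 𝒜))).subset ?_
    rintro l ⟨hlB, hlU⟩
    have hlK : ∃ y ∈ K, f l = (y : FranklinSpace 𝒜) := by
      by_contra! h
      refine hlU (hKU ?_)
      rcases hfl : f l with - | y
      · exact Or.inr rfl
      · exact Or.inl ⟨y, fun hy => h y hy hfl, rfl⟩
    obtain ⟨y, hy, hly⟩ := hlK
    rcases y with n | A
    · exact absurd ⟨n, hly.symm⟩ (hBL hlB)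
    · exact Set.mem_biUnion (show A ∈ _ from hy) ⟨hlB, by simp [hly]⟩
  -- A positive set is positive on L or on its complement, so the glued map is a Katětov reduction.
  · refine absurd ⟨fun l => if l ∈ L then φ l else ψ l, fun B hB hmem => hB ?_⟩ hBI
    rw [← Set.inter_union_compl B L]
    refine hI.union_mem _ _ ?_ ?_
    · by_contra h
      refine hφ _ Set.inter_subset_right h (mem_BI_of_subset hmem ?_)
      rintro _ ⟨l, hl, rfl⟩
      exact ⟨l, hl.1, if_pos hl.2⟩
    · by_contra h
      refine hψ _ Set.inter_subset_right h (mem_BI_of_subset hmem ?_)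
      rintro _ ⟨l, hl, rfl⟩
      exact ⟨l, hl.1, if_neg hl.2⟩

end Construction

theorem mainTheorem12
    (hCH : Cardinal.continuum.{0} = Cardinal.aleph.{0} 1)
    {Λ : Type u} [Countable Λ] [Infinite Λ] (I : Set (Set Λ)) (hI : IsIdealOn I) :
    (¬ KatetovLE BI I ↔
      ∃ (X : Type v) (_ : TopologicalSpace X), T2Space X ∧ FinBW I X ∧ ¬ HindmanSpace X) ∧
    (¬ KatetovLE BI I ↔
      ∃ (X : Type v) (_ : TopologicalSpace X), T2Space X ∧ FinBW I X ∧ ¬ RamseySpace X) ∧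
    (¬ KatetovLE BI I ↔
      ∃ (X : Type v) (_ : TopologicalSpace X), T2Space X ∧ FinBW I X ∧ ¬ DiffCompactSpace X) ∧
    (¬ KatetovLE BI I →
      ∃ 𝒜 : Set (Set ℕ), 𝒜.Infinite ∧ IsMADFamily 𝒜 ∧
        T2Space (FranklinSpace 𝒜) ∧ CompactSpace (FranklinSpace 𝒜) ∧
        TopologicalSpace.SeparableSpace (FranklinSpace 𝒜) ∧
        Cardinal.mk (FranklinSpace 𝒜) = Cardinal.continuum ∧
        FinBW I (FranklinSpace 𝒜) ∧ ¬ HindmanSpace (FranklinSpace 𝒜) ∧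
        ¬ RamseySpace (FranklinSpace 𝒜) ∧ ¬ DiffCompactSpace (FranklinSpace 𝒜)) := by
  obtain ⟨𝒜, h𝒜, hval, hcap⟩ := exists_isMADFamily_capturesMaps hCH hI
  have hinf : 𝒜.Infinite := (Set.infinite_range_of_injective valuationClass_injective).mono
    (Set.range_subset_iff.2 hval)
  have hT2 := FranklinSpace.t2Space h𝒜.1
  have hdiff := FranklinSpace.not_diffCompactSpace h𝒜 hval
  have hFinBW : ¬ KatetovLE BI I → FinBW I (FranklinSpace 𝒜) := fun h =>
    FranklinSpace.finBW hI h hcap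
  -- Moves the space to the universe in which the witness is sought.
  let e : FranklinSpace 𝒜 ≃ₜ ULift.{v} (FranklinSpace 𝒜) := Homeomorph.ulift.symm
  have hlift : T2Space (ULift.{v} (FranklinSpace 𝒜)) := inferInstance
  refine ⟨⟨fun h => ⟨_, _, hlift, (hFinBW h).homeomorph e, fun hX =>
      hdiff (HindmanSpace.diffCompactSpace (hX.homeomorph e.symm))⟩, ?_⟩,
    ⟨fun h => ⟨_, _, hlift, (hFinBW h).homeomorph e, fun hX =>
      hdiff (RamseySpace.diffCompactSpace (hX.homeomorph e.symm))⟩, ?_⟩,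
    ⟨fun h => ⟨_, _, hlift, (hFinBW h).homeomorph e, fun hX =>
      hdiff (hX.homeomorph e.symm)⟩, ?_⟩,
    fun h => ⟨𝒜, hinf, h𝒜, hT2, inferInstance, FranklinSpace.separableSpace h𝒜.1,
      FranklinSpace.mk_eq_continuum hCH h𝒜 hinf, hFinBW h,
      fun hX => hdiff hX.diffCompactSpace, fun hX => hdiff hX.diffCompactSpace, hdiff⟩⟩
  · rintro ⟨X, _, _, hX, hno⟩ hle
    exact hno (hX.of_katetovLE hle).hindmanSpace
  · rintro ⟨X, _, _, hX, hno⟩ hle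
    exact hno (hX.of_katetovLE hle).ramseySpace
  · rintro ⟨X, _, _, hX, hno⟩ hle
    exact hno (hX.of_katetovLE hle).ramseySpace.diffCompactSpace
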